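/- Let $m,n\ge 2$, and let $K_{m,n}$ be the complete bipartite graph. A signing of a graph $G$ is a map $\sigma:E(G)\to\{1,-1\}$; the adjacency matrix $A_\Gamma$ of the signed graph $\Gamma=(G,\sigma)$ is obtained from that of $G$ by replacing the two entries belonging to each edge $e$ with $\sigma(e)$. The Estrada index of $\Gamma$ is $EE(\Gamma)=\sum_i e^{\mu_i}$, where the $\mu_i$ are the eigenvalues of $A_\Gamma$ with multiplicity. $\Gamma$ is unbalanced if some cycle of $\Gamma$ contains an odd number of negative edges. Two signings of $G$ are switching equivalent if one is obtained from the other by reversing the signs of all edges between some vertex set $Z\subseteq V(G)$ and its complement. Theorem. There are signed graphs on $K_{m,n}$ with exactly one negative edge, and each of them is unbalanced. If $\Gamma^*$ is any one of them and $\Gamma=(K_{m,n},\sigma)$ is any unbalanced signed complete bipartite graph, then $$EE(\Gamma)\le EE(\Gamma^*),$$ with equality if and only if $\Gamma$ is switching equivalent to a signing of $K_{m,n}$ with exactly one negative edge. -/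

import Mathlib

/-- A signing of a simple graph `G`: a function from the edge set of `G` to `{1, -1}`.
A signed graph is a pair `(G, σ)` with `σ : Signing G`. -/
abbrev Signing {V : Type*} (G : SimpleGraph V) := G.edgeSet → ℤˣ

namespace Signing

variable {V : Type*} {G : SimpleGraph V}

open Classical in
/-- The sign of a pair of vertices as an integer: `1` or `-1` for a positive or negative edge,
and `0` for a pair that is not an edge. -/
noncomputable def val (σ : Signing G) (e : Sym2 V) : ℤ :=
  if h : e ∈ G.edgeSet then ((σ ⟨e, h⟩ : ℤˣ) : ℤ) else 0

/-- The adjacency matrix of the signed graph `(G, σ)`. -/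
noncomputable def adjMatrix (σ : Signing G) : Matrix V V ℝ :=
  Matrix.of fun i j => (σ.val s(i, j) : ℝ)

theorem adjMatrix_isHermitian (σ : Signing G) : σ.adjMatrix.IsHermitian := by
  ext i j
  simp [adjMatrix, Sym2.eq_swap]

/-- The Estrada index `∑ exp (μ i)`, over the eigenvalues `μ i` of the adjacency matrix, listed
with multiplicity. -/
noncomputable def estradaIndex [Fintype V] [DecidableEq V] (σ : Signing G) : ℝ :=
  ∑ i, Real.exp (σ.adjMatrix_isHermitian.eigenvalues i)

/-- The sign of a walk: the product of the signs of its edges. -/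
noncomputable def walkSign (σ : Signing G) {u v : V} (w : G.Walk u v) : ℤ :=
  (w.edges.map σ.val).prod

/-- A signed graph is balanced if all of its cycles are positive. -/
def IsBalanced (σ : Signing G) : Prop :=
  ∀ (v : V) (c : G.Walk v v), c.IsCycle → σ.walkSign c = 1

open Classical in
/-- Switching at `Z`: the signs of the edges in the cut between `Z` and its complement are
reversed. -/
noncomputable def switch (σ : Signing G) (Z : Set V) : Signing G := fun e =>
  if ∃ u ∈ Z, ∃ v ∉ Z, (e : Sym2 V) = s(u, v) then -σ e else σ e

/-- Two signings of the same graph are switching equivalent if one arises from the other by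
switching at some set of vertices. -/
def SwitchingEquivalent (σ τ : Signing G) : Prop :=
  ∃ Z : Set V, τ = σ.switch Z

/-- Exactly one edge is negative. -/
def HasOneNegativeEdge (σ : Signing G) : Prop :=
  ∃! e : G.edgeSet, σ e = -1

end Signing

/-! ### Power sums of nonnegative reals with prescribed total and maximum -/

section PowerSums

variable {ι : Type*}

/-! Let `B` be the block of signs between the two sides. Expanding the exponential, the Estrada
index is the sum of `tr A ^ k / k!`; odd traces vanish and even ones are twice the traces of powers
of `B * Bᵀ`. It therefore suffices to compare power sums of the eigenvalues of `B * Bᵀ`, which are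
nonnegative with sum `S = mn` for every signing.

For one negative edge the block `oneNeg i j` has rank at most two, so its squared singular values
are `L`, `S - L` and zeros. Among nonnegative numbers at most `L` with sum `S`, these have the
largest power sums. All that remains is to bound every eigenvalue of `B * Bᵀ` by `L`
(`IsUnbalancedSign.eigenvalue_le`): switching makes a singular pair of `B` nonnegative, some entry
`(i, j)` is still `-1` by unbalance, and raising all other entries to `1` can only increase the
bilinear form.

If the indices agree, so do all traces; the fourth one already forces the eigenvalue `L` to occur,
and tracing equality through the bound shows that the switched block is `oneNeg i j`. -/

theorem add_pow_sub_pow_le_add_pow_sub_pow {x y δ : ℝ} (hx : 0 ≤ x) (hxy : x ≤ y) (hδ : 0 ≤ δ)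
    (k : ℕ) : (x + δ) ^ k - x ^ k ≤ (y + δ) ^ k - y ^ k := by
  induction k with
  | zero => simp
  | succ k ih =>
    have h1 : x ^ k ≤ y ^ k := pow_le_pow_left₀ hx hxy k
    have h2 : 0 ≤ (x + δ) ^ k - x ^ k := sub_nonneg.2 (pow_le_pow_left₀ hx (by linarith) k)
    have h3 : (x + δ) * ((x + δ) ^ k - x ^ k) ≤ (y + δ) * ((y + δ) ^ k - y ^ k) :=
      mul_le_mul (by linarith) ih h2 (by linarith)
    have h4 : δ * x ^ k ≤ δ * y ^ k := mul_le_mul_of_nonneg_left h1 hδ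
    calc _ = (x + δ) * ((x + δ) ^ k - x ^ k) + δ * x ^ k := by ring
      _ ≤ (y + δ) * ((y + δ) ^ k - y ^ k) + δ * y ^ k := by linarith
      _ = _ := by ring

/-- For two numbers with sum `S`, the power sums increase with the larger of the two. -/
theorem pow_add_pow_le_of_le {M L S : ℝ} (hM : S ≤ 2 * M) (hML : M ≤ L) (hL : L ≤ S) (k : ℕ) :
    M ^ k + (S - M) ^ k ≤ L ^ k + (S - L) ^ k := by
  have h := add_pow_sub_pow_le_add_pow_sub_pow (x := S - L) (y := M) (δ := L - M)
    (by linarith) (by linarith) (by linarith) k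
  rw [show S - L + (L - M) = S - M by ring, show M + (L - M) = L by ring] at h
  linarith

theorem sum_pow_succ_le {s : Finset ι} {v : ι → ℝ} {M : ℝ} (h0 : ∀ i ∈ s, 0 ≤ v i)
    (hM : ∀ i ∈ s, v i ≤ M) (k : ℕ) : ∑ i ∈ s, v i ^ (k + 1) ≤ (∑ i ∈ s, v i) * M ^ k := by
  rw [Finset.sum_mul]
  refine Finset.sum_le_sum fun i hi => ?_
  rw [pow_succ']
  exact mul_le_mul_of_nonneg_left (pow_le_pow_left₀ (h0 i hi) (hM i hi) k) (h0 i hi)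

variable [Fintype ι]

/-- Nonnegative numbers with sum `S` have power sums at most those of the pair consisting of
their maximum (or of `S / 2`, if that is larger) and its complement to `S`. -/
theorem exists_sum_pow_succ_le {v : ι → ℝ} {L S : ℝ} (h0 : ∀ i, 0 ≤ v i)
    (hL : ∀ i, v i ≤ L) (hS : ∑ i, v i = S) (h2 : S ≤ 2 * L) :
    ∃ M, (M = S / 2 ∨ ∃ i, M = v i) ∧ S ≤ 2 * M ∧ M ≤ L ∧ M ≤ S ∧
      ∀ k : ℕ, ∑ i, v i ^ (k + 1) ≤ M ^ (k + 1) + (S - M) ^ (k + 1) := by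
  classical
  have hS0 : 0 ≤ S := hS ▸ Finset.sum_nonneg fun i _ => h0 i
  by_cases h : ∃ a, S ≤ 2 * v a
  · obtain ⟨a, ha⟩ := h
    have hsum := Finset.add_sum_erase Finset.univ v (Finset.mem_univ a)
    have hle : v a ≤ S := hS ▸ Finset.single_le_sum (fun i _ => h0 i) (Finset.mem_univ a)
    refine ⟨v a, Or.inr ⟨a, rfl⟩, ha, hL a, hle, fun k => ?_⟩
    rw [← Finset.add_sum_erase Finset.univ (fun i => v i ^ (k + 1)) (Finset.mem_univ a)]
    have hrest : ∑ i ∈ Finset.univ.erase a, v i = S - v a := by linarith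
    have := sum_pow_succ_le (s := Finset.univ.erase a) (v := v) (M := S - v a)
      (fun i _ => h0 i)
      (fun i hi => hrest ▸ Finset.single_le_sum (f := v) (fun i _ => h0 i) hi) k
    rw [hrest, ← pow_succ'] at this
    linarith
  -- All numbers are below `S / 2`, so the power sum is at most `S * (S / 2) ^ k = 2 * (S / 2) ^ (k
  -- + 1)`.
  · push Not at h
    refine ⟨S / 2, Or.inl rfl, by linarith, by linarith, by linarith, fun k => ?_⟩
    have := sum_pow_succ_le (s := Finset.univ) (v := v) (M := S / 2) (fun i _ => h0 i)
      (fun i _ => by linarith [h i]) k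
    rw [hS] at this
    calc _ ≤ _ := this
      _ = _ := by ring

theorem sum_pow_succ_le_of_le {v : ι → ℝ} {L S : ℝ} (h0 : ∀ i, 0 ≤ v i)
    (hL : ∀ i, v i ≤ L) (hS : ∑ i, v i = S) (h2 : S ≤ 2 * L) (hLS : L ≤ S) (k : ℕ) :
    ∑ i, v i ^ (k + 1) ≤ L ^ (k + 1) + (S - L) ^ (k + 1) := by
  obtain ⟨M, -, hM2, hML, -, hM⟩ := exists_sum_pow_succ_le h0 hL hS h2
  exact (hM k).trans (pow_add_pow_le_of_le hM2 hML hLS _)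

/-- Squares suffice to detect equality. If all numbers stay below `L` and `S < 2 * L`, the
dominating pair has `M < L` and loses `2 * (L - M) * (L + M - S) > 0`; if `S = 2 * L`, the target is
`L * S`, and some positive `v i` gives `v i ^ 2 < v i * L`. -/
theorem exists_eq_of_sum_sq_eq [Nonempty ι] {v : ι → ℝ} {L S : ℝ} (h0 : ∀ i, 0 ≤ v i)
    (hL : ∀ i, v i ≤ L) (hS : ∑ i, v i = S) (h2 : S ≤ 2 * L)
    (heq : ∑ i, v i ^ 2 = L ^ 2 + (S - L) ^ 2) : ∃ i, v i = L := by
  by_contra! hne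
  have hlt : ∀ i, v i < L := fun i => lt_of_le_of_ne (hL i) (hne i)
  rcases h2.lt_or_eq with h2 | h2
  · obtain ⟨M, hM', hM2, hML, -, hM⟩ := exists_sum_pow_succ_le h0 hL hS h2.le
    have hlt' : M < L := by
      rcases hM' with rfl | ⟨i, rfl⟩
      · linarith
      · exact hlt i
    have := hM 1
    simp only [Nat.reduceAdd] at this
    nlinarith [mul_pos (sub_pos.2 hlt') (show 0 < L + M - S by linarith)]
  · have hlt2 : ∑ i, v i ^ 2 ≤ ∑ i, v i * L :=
      Finset.sum_le_sum fun i _ => by nlinarith [h0 i, hL i]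
    have hpos : 0 < L := (h0 (Classical.arbitrary ι)).trans_lt (hlt _)
    have hex : ∃ i ∈ Finset.univ, 0 < v i := by
      apply Finset.exists_lt_of_sum_lt
      simp only [Finset.sum_const_zero, hS]
      linarith
    obtain ⟨i, hi, hi0⟩ := hex
    have hlt3 : ∑ i, v i ^ 2 < ∑ i, v i * L :=
      Finset.sum_lt_sum (fun i _ => by nlinarith [h0 i, hL i]) ⟨i, hi, by nlinarith [hlt i]⟩
    rw [← Finset.sum_mul, hS, heq, h2] at hlt3
    nlinarith

/-- If at most two of the numbers are nonzero, the power sums are those of a pair. -/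
theorem exists_sum_pow_succ_eq {v : ι → ℝ} (hcard : (Finset.univ.filter fun i => v i ≠ 0).card ≤ 2)
    {a : ι} (ha : v a ≠ 0) :
    ∃ r, (r = 0 ∨ ∃ b, r = v b) ∧ ∀ k : ℕ, ∑ i, v i ^ (k + 1) = v a ^ (k + 1) + r ^ (k + 1) := by
  classical
  have key : ∀ k : ℕ, ∑ i, v i ^ (k + 1) = v a ^ (k + 1) +
      ∑ i ∈ (Finset.univ.filter fun i => v i ≠ 0).erase a, v i ^ (k + 1) := by
    intro k
    rw [Finset.add_sum_erase _ (fun i => v i ^ (k + 1)) (by simp [ha]), Finset.sum_filter]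
    refine Finset.sum_congr rfl fun i _ => ?_
    split_ifs with h
    · rfl
    · simp [not_not.1 h]
  have hc : ((Finset.univ.filter fun i => v i ≠ 0).erase a).card ≤ 1 := by
    rw [Finset.card_erase_of_mem (by simp [ha])]
    omega
  have : Nonempty ι := ⟨a⟩
  obtain ⟨b, hb⟩ := Finset.card_le_one_iff_subset_singleton.1 hc
  -- The value `r = 0` serves when `a` is the only nonzero index.
  rcases Finset.subset_singleton_iff.1 hb with h | h
  · exact ⟨0, Or.inl rfl, fun k => by rw [key, h]; simp⟩
  · exact ⟨v b, Or.inr ⟨b, rfl⟩, fun k => by rw [key, h]; simp⟩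

end PowerSums

/-! ### Traces of powers, eigenvalues and the Rayleigh bound -/

namespace Matrix

section Hermitian

variable {α : Type*} [Fintype α] [DecidableEq α]

theorem IsHermitian.trace_pow_eq_sum_eigenvalues_pow {A : Matrix α α ℝ} (hA : A.IsHermitian)
    (k : ℕ) : (A ^ k).trace = ∑ i, hA.eigenvalues i ^ k := by
  conv_lhs => rw [hA.spectral_theorem, ← map_pow, Unitary.conjStarAlgAut_apply, trace_mul_comm,
    ← mul_assoc]
  simp [diagonal_pow, trace_diagonal]

theorem IsHermitian.hasSum_trace_pow_div_factorial {A : Matrix α α ℝ} (hA : A.IsHermitian) :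
    HasSum (fun k : ℕ => (A ^ k).trace / k.factorial) (∑ i, Real.exp (hA.eigenvalues i)) := by
  simp only [hA.trace_pow_eq_sum_eigenvalues_pow, Finset.sum_div]
  refine hasSum_sum fun i _ => ?_
  rw [Real.exp_eq_exp_ℝ]
  exact NormedSpace.expSeries_div_hasSum_exp _

theorem IsHermitian.dotProduct_mulVec_le {A : Matrix α α ℝ} (hA : A.IsHermitian) {L : ℝ}
    (hL : ∀ i, hA.eigenvalues i ≤ L) (x : α → ℝ) : x ⬝ᵥ A *ᵥ x ≤ L * (x ⬝ᵥ x) := by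
  set U : Matrix α α ℝ := (hA.eigenvectorUnitary : Matrix α α ℝ) with hU
  have hUU : U * Uᵀ = 1 := by
    simpa [star_eq_conjTranspose] using Unitary.coe_mul_star_self hA.eigenvectorUnitary
  have hspec : A = U * diagonal hA.eigenvalues * Uᵀ := by
    conv_lhs => rw [hA.spectral_theorem, Unitary.conjStarAlgAut_apply]
    simp [hU, star_eq_conjTranspose]
  have h1 : x ⬝ᵥ A *ᵥ x = ∑ i, hA.eigenvalues i * (Uᵀ *ᵥ x) i ^ 2 := by
    conv_lhs => rw [hspec]
    rw [← mulVec_mulVec, ← mulVec_mulVec, dotProduct_mulVec, ← mulVec_transpose, dotProduct]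
    refine Finset.sum_congr rfl fun i _ => ?_
    rw [mulVec_diagonal]
    ring
  have h2 : x ⬝ᵥ x = ∑ i, (Uᵀ *ᵥ x) i ^ 2 := by
    have : x ⬝ᵥ x = x ⬝ᵥ U *ᵥ Uᵀ *ᵥ x := by rw [mulVec_mulVec, hUU, one_mulVec]
    rw [this, dotProduct_mulVec, ← mulVec_transpose, dotProduct]
    simp only [sq]
  rw [h1, h2, Finset.mul_sum]
  exact Finset.sum_le_sum fun i _ => mul_le_mul_of_nonneg_right (hL i) (sq_nonneg _)

end Hermitian

/-! ### Trace invariance under permutations and signs; bipartite block matrices -/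

section Traces

variable {α β : Type*} [Fintype α] [Fintype β] [DecidableEq α]

theorem trace_submatrix_equiv_mul_transpose_pow (B : Matrix α β ℝ) (e : α ≃ α) (f : β ≃ β)
    (k : ℕ) : ((B.submatrix e f * (B.submatrix e f)ᵀ) ^ k).trace = ((B * Bᵀ) ^ k).trace := by
  have h : B.submatrix e f * (B.submatrix e f)ᵀ = (B * Bᵀ).submatrix e e := by
    rw [transpose_submatrix, submatrix_mul_equiv]
  have h2 : ∀ M : Matrix α α ℝ, (M.submatrix e e) ^ k = (M ^ k).submatrix e e := by
    intro M
    exact (map_pow (reindexAlgEquiv ℝ ℝ e.symm) M k).symm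
  rw [h, h2]
  exact Equiv.sum_comp e fun i => ((B * Bᵀ) ^ k) i i

/-- Column signs cancel in `C * Cᵀ`, and row signs act as conjugation by a diagonal involution. -/
theorem trace_sign_mul_transpose_pow (B C : Matrix α β ℝ) (d : α → ℝ) (e : β → ℝ)
    (hd : ∀ a, d a * d a = 1) (he : ∀ b, e b * e b = 1) (hC : ∀ a b, C a b = d a * e b * B a b)
    (k : ℕ) : ((C * Cᵀ) ^ k).trace = ((B * Bᵀ) ^ k).trace := by
  have hDD : diagonal d * diagonal d = 1 := by
    rw [diagonal_mul_diagonal]; simp [hd]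
  have h1 : C * Cᵀ = diagonal d * (B * Bᵀ) * diagonal d := by
    ext a a'
    rw [mul_diagonal, diagonal_mul, mul_apply, mul_apply, Finset.mul_sum, Finset.sum_mul]
    refine Finset.sum_congr rfl fun b _ => ?_
    rw [transpose_apply, transpose_apply, hC, hC]
    linear_combination (d a * d a' * B a b * B a' b) * he b
  have h2 : (C * Cᵀ) ^ k = diagonal d * (B * Bᵀ) ^ k * diagonal d := by
    rw [h1]
    induction k with
    | zero => simp [hDD]
    | succ k ih =>
      rw [pow_succ, ih, pow_succ]
      calc _ = diagonal d * (B * Bᵀ) ^ k * (diagonal d * diagonal d) * (B * Bᵀ) * diagonal d := by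
            simp only [mul_assoc]
        _ = _ := by rw [hDD]; simp only [mul_assoc, mul_one]
  rw [h2, trace_mul_comm, ← mul_assoc, hDD, one_mul]

variable [DecidableEq β]

/-- The exponent is positive because the zeroth powers have the sizes of the two sides as traces. -/
theorem trace_transpose_mul_self_pow_succ (B : Matrix α β ℝ) (k : ℕ) :
    ((Bᵀ * B) ^ (k + 1)).trace = ((B * Bᵀ) ^ (k + 1)).trace := by
  have h : ∀ k : ℕ, (Bᵀ * B) ^ k * Bᵀ = Bᵀ * (B * Bᵀ) ^ k := by
    intro k
    induction k with
    | zero => simp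
    | succ k ih => rw [pow_succ', pow_succ', Matrix.mul_assoc, ih]; simp only [Matrix.mul_assoc]
  rw [pow_succ, ← Matrix.mul_assoc, h, trace_mul_comm, ← Matrix.mul_assoc, ← pow_succ']

theorem fromBlocks_zero_pow_two_mul (B : Matrix α β ℝ) (k : ℕ) :
    (fromBlocks 0 B Bᵀ 0) ^ (2 * k) = fromBlocks ((B * Bᵀ) ^ k) 0 0 ((Bᵀ * B) ^ k) := by
  rw [pow_mul]
  induction k with
  | zero => simp
  | succ k ih => rw [pow_succ, ih]; simp [pow_two, fromBlocks_multiply, ← pow_succ]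

theorem trace_fromBlocks_zero_pow_odd (B : Matrix α β ℝ) (k : ℕ) :
    ((fromBlocks 0 B Bᵀ 0) ^ (2 * k + 1)).trace = 0 := by
  rw [pow_succ, fromBlocks_zero_pow_two_mul]
  simp [fromBlocks_multiply, trace]

theorem trace_fromBlocks_zero_pow_even (B : Matrix α β ℝ) (k : ℕ) :
    ((fromBlocks 0 B Bᵀ 0) ^ (2 * (k + 1))).trace = 2 * ((B * Bᵀ) ^ (k + 1)).trace := by
  have h : (fromBlocks ((B * Bᵀ) ^ (k + 1)) 0 0 ((Bᵀ * B) ^ (k + 1))).trace =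
      ((B * Bᵀ) ^ (k + 1)).trace + ((Bᵀ * B) ^ (k + 1)).trace := by
    simp [trace]
  rw [fromBlocks_zero_pow_two_mul, h, trace_transpose_mul_self_pow_succ]
  ring

end Traces

end Matrix

/-! ### Sign matrices with a single negative entry -/

namespace Matrix

variable {α β : Type*} [Fintype α] [Fintype β] [DecidableEq α] [DecidableEq β]

/-- The matrix with entry `-1` at position `(i, j)` and `1` elsewhere. -/
def oneNeg (i : α) (j : β) : Matrix α β ℝ :=
  of fun a b => if a = i ∧ b = j then -1 else 1

/-- A matrix of signs. -/
def IsSign (B : Matrix α β ℝ) : Prop := ∀ a b, B a b = 1 ∨ B a b = -1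

omit [Fintype α] [Fintype β] in
theorem oneNeg_isSign (i : α) (j : β) : (oneNeg i j).IsSign := by
  intro a b
  by_cases h : a = i ∧ b = j <;> simp [oneNeg, h]

omit [Fintype α] [Fintype β] in
theorem oneNeg_eq_submatrix (i i' : α) (j j' : β) :
    oneNeg i j = (oneNeg i' j').submatrix (Equiv.swap i i') (Equiv.swap j j') := by
  ext a b
  simp [oneNeg, Equiv.swap_apply_eq_iff]

theorem trace_oneNeg_pow (i i' : α) (j j' : β) (k : ℕ) :
    ((oneNeg i j * (oneNeg i j)ᵀ) ^ k).trace = ((oneNeg i' j' * (oneNeg i' j')ᵀ) ^ k).trace := by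
  rw [oneNeg_eq_submatrix i i' j j', trace_submatrix_equiv_mul_transpose_pow]

omit [DecidableEq α] [DecidableEq β] in
theorem IsSign.trace_mul_transpose {B : Matrix α β ℝ} (hB : B.IsSign) :
    (B * Bᵀ).trace = Fintype.card α * Fintype.card β := by
  have : ∀ a b, B a b * B a b = 1 := fun a b => by rcases hB a b with h | h <;> simp [h]
  simp [trace, mul_apply, this]

omit [Fintype α] in
-- The matrix is the all-ones matrix minus twice a matrix unit.
theorem rank_oneNeg_le (i : α) (j : β) : (oneNeg i j).rank ≤ 2 := by
  have h : oneNeg i j = (of fun a (k : Fin 2) => if k = 0 then 1 else if a = i then (1 : ℝ) else 0) *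
      (of fun (k : Fin 2) b => if k = 0 then 1 else if b = j then (-2 : ℝ) else 0) := by
    ext a b
    by_cases h1 : a = i <;> by_cases h2 : b = j <;> simp [oneNeg, mul_apply, h1, h2]
    norm_num
  rw [h]
  exact (rank_mul_le_left _ _).trans ((rank_le_card_width _).trans_eq (Fintype.card_fin 2))

omit [Fintype α] in
theorem oneNeg_mulVec (i : α) (j : β) (y : β → ℝ) (a : α) :
    (oneNeg i j *ᵥ y) a = ∑ b, y b - if a = i then 2 * y j else 0 := by
  have : ∀ b, oneNeg i j a b * y b = y b - if b = j then (if a = i then 2 * y j else 0) else 0 := by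
    intro b
    by_cases h1 : a = i <;> by_cases h2 : b = j <;> simp [oneNeg, h1, h2]
    ring
  simp [mulVec, dotProduct, this]

omit [Fintype β] in
theorem vecMul_oneNeg (i : α) (j : β) (x : α → ℝ) (b : β) :
    (x ᵥ* oneNeg i j) b = ∑ a, x a - if b = j then 2 * x i else 0 := by
  have h : (oneNeg i j)ᵀ = oneNeg j i := by
    ext a b
    simp [oneNeg, and_comm]
  rw [← mulVec_transpose, h, oneNeg_mulVec]

omit [DecidableEq α] [DecidableEq β] in
theorem dotProduct_self_vecMul (B : Matrix α β ℝ) (x : α → ℝ) :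
    (x ᵥ* B) ⬝ᵥ (x ᵥ* B) = x ⬝ᵥ (B * Bᵀ) *ᵥ x := by
  rw [← mulVec_mulVec, mulVec_transpose, dotProduct_mulVec]

omit [DecidableEq α] [DecidableEq β] in
theorem dotProduct_self_nonneg_real (x : α → ℝ) : 0 ≤ x ⬝ᵥ x :=
  Finset.sum_nonneg fun _ _ => mul_self_nonneg _

/-! ### Extremal singular pairs and the equality case -/

section SingularPair

variable {C : Matrix α β ℝ} {X : α → ℝ} {Y : β → ℝ} {L μ : ℝ}

omit [DecidableEq α] [DecidableEq β] in
-- Expanding `0 ≤ |X ᵥ* E - Y|²` gives `2 * (X ⬝ᵥ E *ᵥ Y) ≤ L * |X|² + |Y|²`, hence `|Y|² ≤ L *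
-- |X|²`.
theorem le_of_le_dotProduct_mulVec {E : Matrix α β ℝ}
    (hE : (X ᵥ* E) ⬝ᵥ (X ᵥ* E) ≤ L * (X ⬝ᵥ X)) (hY : Y ⬝ᵥ Y = μ * (X ⬝ᵥ X))
    (hle : Y ⬝ᵥ Y ≤ X ⬝ᵥ E *ᵥ Y) (hX : 0 < X ⬝ᵥ X) : μ ≤ L := by
  have h := dotProduct_self_nonneg_real (X ᵥ* E - Y)
  have h2 : X ᵥ* E ⬝ᵥ Y = X ⬝ᵥ E *ᵥ Y := (dotProduct_mulVec _ _ _).symm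
  rw [sub_dotProduct, dotProduct_sub, dotProduct_sub, dotProduct_comm Y, h2] at h
  have h3 : μ * (X ⬝ᵥ X) ≤ L * (X ⬝ᵥ X) := by linarith
  exact le_of_mul_le_mul_right h3 hX

omit [DecidableEq α] [DecidableEq β] in
/-- A pair of vectors on which the bilinear form of `E` attains its maximal value is a pair of
singular vectors. -/
theorem singular_pair_of_le {E : Matrix α β ℝ} (hL : 0 < L)
    (hE : ∀ x, (x ᵥ* E) ⬝ᵥ (x ᵥ* E) ≤ L * (x ⬝ᵥ x)) (hY : Y ⬝ᵥ Y = L * (X ⬝ᵥ X))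
    (hle : Y ⬝ᵥ Y ≤ X ⬝ᵥ E *ᵥ Y) :
    X ᵥ* E = Y ∧ E *ᵥ Y = L • X ∧ X ⬝ᵥ E *ᵥ Y = Y ⬝ᵥ Y := by
  have h1 : X ᵥ* E = Y := by
    have h := dotProduct_self_nonneg_real (X ᵥ* E - Y)
    have h2 : X ᵥ* E ⬝ᵥ Y = X ⬝ᵥ E *ᵥ Y := (dotProduct_mulVec _ _ _).symm
    have h3 : (X ᵥ* E - Y) ⬝ᵥ (X ᵥ* E - Y) = 0 := by
      refine le_antisymm ?_ h
      rw [sub_dotProduct, dotProduct_sub, dotProduct_sub, dotProduct_comm Y, h2]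
      linarith [hE X]
    exact sub_eq_zero.1 (dotProduct_self_eq_zero.1 h3)
  have hXY : X ⬝ᵥ E *ᵥ Y = Y ⬝ᵥ Y := by rw [dotProduct_mulVec, h1]
  refine ⟨h1, ?_, hXY⟩
  set z := E *ᵥ Y with hz
  have hz1 : z ᵥ* E ⬝ᵥ Y = z ⬝ᵥ z := by rw [← dotProduct_mulVec]
  -- The norm bound for `Eᵀ` passes to `E`, by expanding `0 ≤ |z ᵥ* E - L • Y|²`.
  have hz2 : z ⬝ᵥ z ≤ L * (Y ⬝ᵥ Y) := by
    have h := dotProduct_self_nonneg_real (z ᵥ* E - L • Y)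
    rw [sub_dotProduct, dotProduct_sub, dotProduct_sub, smul_dotProduct, smul_dotProduct,
      dotProduct_smul, dotProduct_smul, dotProduct_comm Y, hz1] at h
    simp only [smul_eq_mul] at h
    have := hE z
    by_contra! hlt
    nlinarith [mul_lt_mul_of_pos_left hlt hL]
  have h3 : (z - L • X) ⬝ᵥ (z - L • X) = 0 := by
    refine le_antisymm ?_ (dotProduct_self_nonneg_real _)
    rw [sub_dotProduct, dotProduct_sub, dotProduct_sub, smul_dotProduct, smul_dotProduct,
      dotProduct_smul, dotProduct_smul, dotProduct_comm z X, hXY]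
    simp only [smul_eq_mul]
    have : L * (L * (X ⬝ᵥ X)) = L * (Y ⬝ᵥ Y) := by rw [hY]
    linarith
  exact sub_eq_zero.1 (dotProduct_self_eq_zero.1 h3)

/-- Serves the degenerate case where the singular vector vanishes at `i`: then `Y` is constant and
positive, and `∑ b, Y b = 2 * Y j` leaves only two columns, so row `i` is entirely negative. The
factor `q` allows use on the transpose as well, with `q = L` instead of `1`. -/
theorem apply_eq_ite_of_apply_eq_zero {i : α} {j b₀ : β} {q : ℝ}
    (hq : 0 < q) (hX : ∀ a, a ≠ i → 0 < X a) (hY : ∀ b, q * Y b = ∑ a, X a) (hs : 0 < ∑ a, X a)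
    (hXY : 0 = ∑ b, Y b - 2 * Y j)
    (hzero : ∀ a b, C a b = oneNeg i j a b ∨ X a * Y b = 0)
    (hj : C i j = -1) (hb : b₀ ≠ j) (hCb : C i b₀ = -1) (a : α) (b : β) :
    C a b = if a = i then -1 else 1 := by
  have hYj : ∀ b, Y b = Y j := fun b => by
    have := (hY b).trans (hY j).symm
    exact mul_left_cancel₀ hq.ne' this
  have hYpos : ∀ b, 0 < Y b := fun b => pos_of_mul_pos_right ((hY b).symm ▸ hs) hq.le
  have hcard : Fintype.card β = 2 := by
    simp only [hYj, Finset.sum_const, Finset.card_univ, nsmul_eq_mul] at hXY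
    have : ((Fintype.card β : ℝ) - 2) * Y j = 0 := by linarith
    rcases mul_eq_zero.1 this with h | h
    · exact_mod_cast sub_eq_zero.1 h
    · exact absurd h (hYpos j).ne'
  have huniv : ({b₀, j} : Finset β) = Finset.univ :=
    Finset.eq_univ_of_card _ (by rw [Finset.card_pair hb, hcard])
  split_ifs with ha
  · have : b ∈ ({b₀, j} : Finset β) := huniv ▸ Finset.mem_univ b
    rcases Finset.mem_insert.1 this with rfl | h
    · rw [ha, hCb]
    · rw [ha, Finset.mem_singleton.1 h, hj]
  · rcases hzero a b with h | h
    · simp [h, oneNeg, ha]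
    · exact absurd h (mul_pos (hX a ha) (hYpos b)).ne'

omit [DecidableEq α] [DecidableEq β] in
theorem dotProduct_mulVec_eq_sum (E : Matrix α β ℝ) (X : α → ℝ) (Y : β → ℝ) :
    X ⬝ᵥ E *ᵥ Y = ∑ a, ∑ b, E a b * (X a * Y b) := by
  simp only [dotProduct, mulVec, Finset.mul_sum]
  exact Finset.sum_congr rfl fun a _ => Finset.sum_congr rfl fun b _ => by ring

omit [Fintype α] [Fintype β] in
theorem IsSign.le_oneNeg (hC : C.IsSign) {i : α} {j : β} (hij : C i j = -1) (a : α) (b : β) :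
    C a b ≤ oneNeg i j a b := by
  by_cases h : a = i ∧ b = j
  · simp [oneNeg, h, hij]
  · rcases hC a b with h' | h' <;> simp [oneNeg, h, h']

/-- Equality of the forms makes `C` agree with `oneNeg i j` wherever `X a * Y b ≠ 0`. The singular
equations make `X` positive off `i` and `Y` positive off `j`, so a disagreement needs `X i = 0` or
`Y j = 0`, which leads to a wholly negative row or column, excluded by `hrow` and `hcol`. -/
theorem eq_oneNeg_of_singular_pair (hC : C.IsSign) {i : α} {j : β} (hij : C i j = -1)
    (hrow : ¬ ∀ a b, C a b = if a = i then -1 else 1)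
    (hcol : ¬ ∀ a b, C a b = if b = j then -1 else 1)
    (hX0 : ∀ a, 0 ≤ X a) (hY0 : ∀ b, 0 ≤ Y b) (hL : 0 < L) (hX : X ≠ 0)
    (h1 : X ᵥ* oneNeg i j = Y) (h2 : oneNeg i j *ᵥ Y = L • X)
    (heq : X ⬝ᵥ oneNeg i j *ᵥ Y = X ⬝ᵥ C *ᵥ Y) : C = oneNeg i j := by
  have hzero : ∀ a b, C a b = oneNeg i j a b ∨ X a * Y b = 0 := by
    rw [dotProduct_mulVec_eq_sum, dotProduct_mulVec_eq_sum, ← sub_eq_zero,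
      ← Finset.sum_sub_distrib] at heq
    simp only [← Finset.sum_sub_distrib, ← sub_mul] at heq
    have hnn : ∀ a b, 0 ≤ (oneNeg i j a b - C a b) * (X a * Y b) := fun a b =>
      mul_nonneg (sub_nonneg.2 (hC.le_oneNeg hij a b)) (mul_nonneg (hX0 a) (hY0 b))
    intro a b
    have ha := (Finset.sum_eq_zero_iff_of_nonneg
      (fun a _ => Finset.sum_nonneg fun b _ => hnn a b)).1 heq a (Finset.mem_univ a)
    have hb := (Finset.sum_eq_zero_iff_of_nonneg (fun b _ => hnn a b)).1 ha b (Finset.mem_univ b)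
    exact (mul_eq_zero.1 hb).imp_left fun h => (sub_eq_zero.1 h).symm
  have hs : 0 < ∑ a, X a := by
    refine lt_of_le_of_ne (Finset.sum_nonneg fun a _ => hX0 a) fun h => hX ?_
    funext a
    exact (Finset.sum_eq_zero_iff_of_nonneg fun a _ => hX0 a).1 h.symm a (Finset.mem_univ a)
  have ht : 0 < ∑ b, Y b := by
    refine lt_of_le_of_ne (Finset.sum_nonneg fun b _ => hY0 b) fun h => hX ?_
    have hY : Y = 0 := by
      funext b
      exact (Finset.sum_eq_zero_iff_of_nonneg fun b _ => hY0 b).1 h.symm b (Finset.mem_univ b)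
    rw [hY, mulVec_zero] at h2
    exact (smul_eq_zero.1 h2.symm).resolve_left hL.ne'
  have eX : ∀ a, L * X a = ∑ b, Y b - if a = i then 2 * Y j else 0 := fun a => by
    rw [← oneNeg_mulVec, h2]; rfl
  have eY : ∀ b, 1 * Y b = ∑ a, X a - if b = j then 2 * X i else 0 := fun b => by
    rw [← vecMul_oneNeg, h1, one_mul]
  have hXpos : ∀ a, a ≠ i → 0 < X a := fun a ha => by
    have := eX a
    rw [if_neg ha, sub_zero] at this
    exact pos_of_mul_pos_right (this ▸ ht) hL.le
  have hYpos : ∀ b, b ≠ j → 0 < Y b := fun b hb => by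
    have := eY b
    rw [if_neg hb, sub_zero, one_mul] at this
    exact this ▸ hs
  ext a b
  by_contra hne
  have hneg : C a b = -1 ∧ ¬ (a = i ∧ b = j) := by
    have hn : ¬ (a = i ∧ b = j) := by
      rintro ⟨rfl, rfl⟩
      exact hne (by simp [hij, oneNeg])
    refine ⟨(hC a b).resolve_left fun h => hne ?_, hn⟩
    simp [h, oneNeg, hn]
  rcases mul_eq_zero.1 ((hzero a b).resolve_left hne) with h | h
  · obtain rfl : a = i := by
      by_contra ha
      exact (hXpos a ha).ne' h
    have hXY := eX a
    rw [h, if_pos rfl, mul_zero] at hXY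
    refine hrow (apply_eq_ite_of_apply_eq_zero one_pos hXpos (fun b => ?_) hs hXY hzero hij
      (b₀ := b) (fun hb => hneg.2 ⟨rfl, hb⟩) hneg.1)
    rw [eY, h]
    simp
  · obtain rfl : b = j := by
      by_contra hb
      exact (hYpos b hb).ne' h
    have hXY := eY b
    rw [h, if_pos rfl, mul_zero] at hXY
    refine hcol fun a' b' => apply_eq_ite_of_apply_eq_zero (C := Cᵀ) (i := b) (j := i)
      hL hYpos (fun a => ?_) ht hXY (fun b' a' => ?_) hij
      (b₀ := a) (fun ha => hneg.2 ⟨ha, rfl⟩) hneg.1 b' a'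
    · rw [eX, h]
      simp
    · rw [mul_comm]
      refine (hzero a' b').imp_left fun h => ?_
      rw [transpose_apply, h]
      simp [oneNeg, and_comm]

end SingularPair

/-! ### Spectral extremality among unbalanced sign matrices -/

theorem exists_sign_mul_eq_abs {ι : Type*} (x : ι → ℝ) :
    ∃ d : ι → ℝ, (∀ a, d a = 1 ∨ d a = -1) ∧ ∀ a, d a * x a = |x a| := by
  refine ⟨fun a => if 0 ≤ x a then 1 else -1, fun a => ?_, fun a => ?_⟩
  · by_cases h : 0 ≤ x a <;> simp [h]
  · by_cases h : 0 ≤ x a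
    · simp [h, abs_of_nonneg]
    · simp [h, abs_of_neg (not_le.1 h)]

theorem ite_neg_eq_one_or {ι : Type*} [DecidableEq ι] {f : ι → ℝ} (i : ι)
    (hf : ∀ a, f a = 1 ∨ f a = -1) (a : ι) :
    (if a = i then -f a else f a) = 1 ∨ (if a = i then -f a else f a) = -1 := by
  rcases hf a with h | h <;> split_ifs <;> simp [h]

/-- A sign matrix is unbalanced if changing the signs of rows and columns never makes it
entrywise positive. -/
def IsUnbalancedSign (B : Matrix α β ℝ) : Prop :=
  B.IsSign ∧ ∀ (d : α → ℝ) (e : β → ℝ), (∀ a, d a = 1 ∨ d a = -1) → (∀ b, e b = 1 ∨ e b = -1) →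
    ∃ a b, d a * e b * B a b = -1

theorem IsUnbalancedSign.eigenvalue_le {B : Matrix α β ℝ} (hB : B.IsUnbalancedSign) {L μ : ℝ}
    (hL : 0 < L) (hE : ∀ (i : α) (j : β) (x : α → ℝ),
      (x ᵥ* oneNeg i j) ⬝ᵥ (x ᵥ* oneNeg i j) ≤ L * (x ⬝ᵥ x))
    {x : α → ℝ} (hx : x ≠ 0) (hμ : (B * Bᵀ) *ᵥ x = μ • x) :
    μ ≤ L ∧ (μ = L → ∃ (d : α → ℝ) (e : β → ℝ) (i : α) (j : β), (∀ a, d a = 1 ∨ d a = -1) ∧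
      (∀ b, e b = 1 ∨ e b = -1) ∧ ∀ a b, d a * e b * B a b = oneNeg i j a b) := by
  obtain ⟨hS, hU⟩ := hB
  set y := x ᵥ* B with hy
  obtain ⟨d, hd, hdx⟩ := exists_sign_mul_eq_abs x
  obtain ⟨e, he, hey⟩ := exists_sign_mul_eq_abs y
  have hd2 : ∀ a, d a * d a = 1 := fun a => by rcases hd a with h | h <;> simp [h]
  have he2 : ∀ b, e b * e b = 1 := fun b => by rcases he b with h | h <;> simp [h]
  set C : Matrix α β ℝ := of fun a b => d a * e b * B a b with hCdef
  have hC : C.IsSign := fun a b => by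
    rcases hd a with h | h <;> rcases he b with h' | h' <;> rcases hS a b with h'' | h'' <;>
      simp [hCdef, h, h', h'']
  obtain ⟨i, j, hij⟩ := hU d e hd he
  have hij : C i j = -1 := hij
  set X : α → ℝ := fun a => |x a| with hXdef
  set Y : β → ℝ := fun b => |y b| with hYdef
  have hXX : X ⬝ᵥ X = x ⬝ᵥ x := by simp [dotProduct, hXdef]
  have hYY : Y ⬝ᵥ Y = y ⬝ᵥ y := by simp [dotProduct, hYdef]
  have hyy : y ⬝ᵥ y = μ * (x ⬝ᵥ x) := by
    rw [hy, dotProduct_self_vecMul, hμ, dotProduct_smul, smul_eq_mul]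
  have hXCY : X ⬝ᵥ C *ᵥ Y = Y ⬝ᵥ Y := by
    have : y ⬝ᵥ y = x ⬝ᵥ B *ᵥ y := by rw [dotProduct_mulVec]
    rw [hYY, this, dotProduct_mulVec_eq_sum, dotProduct_mulVec_eq_sum]
    refine Finset.sum_congr rfl fun a _ => Finset.sum_congr rfl fun b _ => ?_
    simp only [hXdef, hYdef, hCdef, of_apply, ← hdx, ← hey]
    linear_combination (B a b * x a * y b * e b * e b) * hd2 a + (B a b * x a * y b) * he2 b
  have hX0 : ∀ a, 0 ≤ X a := fun a => abs_nonneg _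
  have hY0 : ∀ b, 0 ≤ Y b := fun b => abs_nonneg _
  have hle : Y ⬝ᵥ Y ≤ X ⬝ᵥ oneNeg i j *ᵥ Y := by
    rw [← hXCY, dotProduct_mulVec_eq_sum, dotProduct_mulVec_eq_sum]
    exact Finset.sum_le_sum fun a _ => Finset.sum_le_sum fun b _ =>
      mul_le_mul_of_nonneg_right (hC.le_oneNeg hij a b) (mul_nonneg (hX0 a) (hY0 b))
  have hXpos : 0 < X ⬝ᵥ X := by
    rw [hXX]
    exact lt_of_le_of_ne (dotProduct_self_nonneg_real x)
      fun h => hx (dotProduct_self_eq_zero.1 h.symm)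
  have hYX : Y ⬝ᵥ Y = μ * (X ⬝ᵥ X) := by rw [hXX, hYY, hyy]
  refine ⟨le_of_le_dotProduct_mulVec (hE i j X) hYX hle hXpos, fun hμL => ?_⟩
  rw [hμL] at hYX
  obtain ⟨h1, h2, h3⟩ := singular_pair_of_le hL (hE i j) hYX hle
  have key := eq_oneNeg_of_singular_pair hC hij (fun h => ?_) (fun h => ?_) hX0 hY0 hL
    (fun h => by simp [h] at hXpos) h1 h2 (h3.trans hXCY.symm)
  · exact ⟨d, e, i, j, hd, he, fun a b => congrFun (congrFun key a) b⟩
  -- Flipping a wholly negative row would make the matrix positive, against unbalance; the next case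
  -- does the same for a column.
  · obtain ⟨a, b, hab⟩ := hU _ e (ite_neg_eq_one_or i hd) he
    have := h a b
    simp only [hCdef, of_apply] at this
    split_ifs at this hab with h'
    · linarith
    · linarith
  · obtain ⟨a, b, hab⟩ := hU d _ hd (ite_neg_eq_one_or j he)
    have := h a b
    simp only [hCdef, of_apply] at this
    split_ifs at this hab with h'
    · linarith
    · linarith

/-- The spectrum of `oneNeg i j * (oneNeg i j)ᵀ` consists of `L`, `S - L` and zeros. -/
theorem exists_trace_oneNeg_pow_eq [Nonempty α] [Nonempty β] (i : α) (j : β) :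
    ∃ L S : ℝ, S = Fintype.card α * Fintype.card β ∧ 0 < L ∧ S ≤ 2 * L ∧ L ≤ S ∧
      (∀ x : α → ℝ, (x ᵥ* oneNeg i j) ⬝ᵥ (x ᵥ* oneNeg i j) ≤ L * (x ⬝ᵥ x)) ∧
      ∀ k : ℕ, ((oneNeg i j * (oneNeg i j)ᵀ) ^ (k + 1)).trace =
        L ^ (k + 1) + (S - L) ^ (k + 1) := by
  set E := oneNeg i j with hE
  have hP : (E * Eᵀ).PosSemidef := by
    simpa [conjTranspose_eq_transpose_of_trivial] using posSemidef_self_mul_conjTranspose E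
  have hH : (E * Eᵀ).IsHermitian := hP.1
  set v := hH.eigenvalues with hv
  have h0 : ∀ p, 0 ≤ v p := fun p => hP.eigenvalues_nonneg p
  obtain ⟨p, hp⟩ := Finite.exists_max v
  have hcard : (Finset.univ.filter fun p => v p ≠ 0).card ≤ 2 := by
    rw [← Fintype.card_subtype, ← hH.rank_eq_card_non_zero_eigs, rank_self_mul_transpose]
    exact rank_oneNeg_le i j
  have hsum : ∑ p, v p = Fintype.card α * Fintype.card β := by
    have := hH.trace_pow_eq_sum_eigenvalues_pow 1
    simp only [pow_one] at this
    rw [← this, (oneNeg_isSign i j).trace_mul_transpose]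
  have hpos : (0 : ℝ) < Fintype.card α * Fintype.card β := by
    have := Fintype.card_pos (α := α)
    have := Fintype.card_pos (α := β)
    positivity
  have hLpos : 0 < v p := by
    refine lt_of_le_of_ne (h0 p) fun h => ?_
    have : ∑ q, v q ≤ 0 := Finset.sum_nonpos fun q _ => h ▸ hp q
    linarith
  obtain ⟨r, hr, hk⟩ := exists_sum_pow_succ_eq hcard hLpos.ne'
  have hr1 : (Fintype.card α * Fintype.card β : ℝ) = v p + r := by
    have := hk 0
    simp only [zero_add, pow_one] at this
    rw [← hsum, this]
  have hr2 : 0 ≤ r ∧ r ≤ v p := by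
    rcases hr with rfl | ⟨b, rfl⟩
    · exact ⟨le_rfl, hLpos.le⟩
    · exact ⟨h0 b, hp b⟩
  refine ⟨v p, _, rfl, hLpos, by linarith, by linarith, fun x => ?_, fun k => ?_⟩
  · rw [dotProduct_self_vecMul]
    exact hH.dotProduct_mulVec_le hp x
  · rw [hH.trace_pow_eq_sum_eigenvalues_pow, hk, hr1, add_sub_cancel_left]

theorem IsUnbalancedSign.trace_pow_le {B : Matrix α β ℝ} (hB : B.IsUnbalancedSign)
    (i : α) (j : β) :
    (∀ k : ℕ, ((B * Bᵀ) ^ (k + 1)).trace ≤ ((oneNeg i j * (oneNeg i j)ᵀ) ^ (k + 1)).trace) ∧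
    (((B * Bᵀ) ^ 2).trace = ((oneNeg i j * (oneNeg i j)ᵀ) ^ 2).trace →
      ∃ (d : α → ℝ) (e : β → ℝ) (i : α) (j : β), (∀ a, d a = 1 ∨ d a = -1) ∧
        (∀ b, e b = 1 ∨ e b = -1) ∧ ∀ a b, d a * e b * B a b = oneNeg i j a b) := by
  have : Nonempty α := ⟨i⟩
  have : Nonempty β := ⟨j⟩
  obtain ⟨L, S, hS, hL, hSL, hLS, hE, htr⟩ := exists_trace_oneNeg_pow_eq i j
  -- The position of the negative entry is not known in advance; row and column swaps show that `L`
  -- serves for all positions.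
  have hE' : ∀ (i' : α) (j' : β) (x : α → ℝ),
      (x ᵥ* oneNeg i' j') ⬝ᵥ (x ᵥ* oneNeg i' j') ≤ L * (x ⬝ᵥ x) := by
    intro i' j' x
    have h := hE (x ∘ Equiv.swap i' i)
    have h1 : (x ∘ Equiv.swap i' i) ⬝ᵥ (x ∘ Equiv.swap i' i) = x ⬝ᵥ x :=
      Equiv.sum_comp (Equiv.swap i' i) fun a => x a * x a
    have h2 : x ᵥ* oneNeg i' j' = ((x ∘ Equiv.swap i' i) ᵥ* oneNeg i j) ∘ Equiv.swap j' j := by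
      funext b
      rw [Function.comp_apply, vecMul_oneNeg, vecMul_oneNeg]
      have : ∑ a, x a = ∑ a, (x ∘ Equiv.swap i' i) a := (Equiv.sum_comp (Equiv.swap i' i) x).symm
      rw [this]
      simp [Equiv.swap_apply_eq_iff]
    rw [h1] at h
    rw [h2]
    refine le_trans (le_of_eq ?_) h
    exact Equiv.sum_comp (Equiv.swap j' j) fun b =>
      ((x ∘ Equiv.swap i' i) ᵥ* oneNeg i j) b * ((x ∘ Equiv.swap i' i) ᵥ* oneNeg i j) b
  have hP : (B * Bᵀ).PosSemidef := by
    simpa [conjTranspose_eq_transpose_of_trivial] using posSemidef_self_mul_conjTranspose B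
  have hH : (B * Bᵀ).IsHermitian := hP.1
  have hsum : ∑ p, hH.eigenvalues p = S := by
    have := hH.trace_pow_eq_sum_eigenvalues_pow 1
    simp only [pow_one] at this
    rw [← this, hB.1.trace_mul_transpose, hS]
  have h0 : ∀ p, 0 ≤ hH.eigenvalues p := fun p => hP.eigenvalues_nonneg p
  have hvec : ∀ p, (hH.eigenvectorBasis p : α → ℝ) ≠ 0 := fun p h =>
    hH.eigenvectorBasis.orthonormal.ne_zero p (by ext a; exact congrFun h a)
  have key := fun p => hB.eigenvalue_le hL hE' (hvec p) (hH.mulVec_eigenvectorBasis p)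
  refine ⟨fun k => ?_, fun h => ?_⟩
  · rw [hH.trace_pow_eq_sum_eigenvalues_pow, htr]
    exact sum_pow_succ_le_of_le h0 (fun p => (key p).1) hsum hSL hLS k
  · rw [hH.trace_pow_eq_sum_eigenvalues_pow, htr 1] at h
    obtain ⟨p, hp⟩ := exists_eq_of_sum_sq_eq h0 (fun p => (key p).1) hsum hSL h
    exact (key p).2 hp

end Matrix

/-! ### Signed complete bipartite graphs: blocks, switching and balance -/

namespace Signing

open Matrix

section CompleteBipartite

variable {α β : Type*}

/-- The block of the adjacency matrix between the two sides of a complete bipartite graph. -/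
noncomputable def biadjMatrix (σ : Signing (completeBipartiteGraph α β)) : Matrix α β ℝ :=
  of fun a b => (σ.val s(Sum.inl a, Sum.inr b) : ℝ)

theorem inl_inr_mem_edgeSet (a : α) (b : β) :
    s(Sum.inl a, Sum.inr b) ∈ (completeBipartiteGraph α β).edgeSet := by
  simp [completeBipartiteGraph]

theorem exists_eq_inl_inr (e : (completeBipartiteGraph α β).edgeSet) :
    ∃ (a : α) (b : β), e = ⟨s(Sum.inl a, Sum.inr b), inl_inr_mem_edgeSet a b⟩ := by
  obtain ⟨e, he⟩ := e
  induction e with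
  | h u v =>
    rcases u with a | b <;> rcases v with a' | b'
    · simp [completeBipartiteGraph] at he
    · exact ⟨a, b', rfl⟩
    · exact ⟨a', b, Subtype.ext Sym2.eq_swap⟩
    · simp [completeBipartiteGraph] at he

theorem biadjMatrix_apply (σ : Signing (completeBipartiteGraph α β)) (a : α) (b : β) :
    σ.biadjMatrix a b = ((σ ⟨s(Sum.inl a, Sum.inr b), inl_inr_mem_edgeSet a b⟩ : ℤˣ) : ℤ) := by
  simp only [biadjMatrix, of_apply, val, dif_pos (inl_inr_mem_edgeSet a b)]

theorem biadjMatrix_isSign (σ : Signing (completeBipartiteGraph α β)) : σ.biadjMatrix.IsSign := by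
  intro a b
  rw [biadjMatrix_apply]
  rcases Int.units_eq_one_or (σ ⟨s(Sum.inl a, Sum.inr b), inl_inr_mem_edgeSet a b⟩) with h | h <;>
    simp [h]

theorem biadjMatrix_eq_neg_one_iff (σ : Signing (completeBipartiteGraph α β)) (a : α) (b : β) :
    σ.biadjMatrix a b = -1 ↔ σ ⟨s(Sum.inl a, Sum.inr b), inl_inr_mem_edgeSet a b⟩ = -1 := by
  rw [biadjMatrix_apply]
  rcases Int.units_eq_one_or (σ ⟨s(Sum.inl a, Sum.inr b), inl_inr_mem_edgeSet a b⟩) with h | h <;>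
    rw [h] <;> norm_num

theorem adjMatrix_eq_fromBlocks (σ : Signing (completeBipartiteGraph α β)) :
    σ.adjMatrix = fromBlocks 0 σ.biadjMatrix σ.biadjMatrixᵀ 0 := by
  ext u v
  rcases u with a | b <;> rcases v with a' | b'
  · simp [adjMatrix, val, completeBipartiteGraph]
  · simp [adjMatrix, biadjMatrix]
  · simp [adjMatrix, biadjMatrix, Sym2.eq_swap]
  · simp [adjMatrix, val, completeBipartiteGraph]

theorem hasOneNegativeEdge_iff [DecidableEq α] [DecidableEq β]
    (σ : Signing (completeBipartiteGraph α β)) :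
    σ.HasOneNegativeEdge ↔ ∃ i j, σ.biadjMatrix = oneNeg i j := by
  constructor
  · rintro ⟨e, he, huniq⟩
    obtain ⟨i, j, rfl⟩ := exists_eq_inl_inr e
    refine ⟨i, j, ?_⟩
    ext a b
    by_cases h : a = i ∧ b = j
    · obtain ⟨rfl, rfl⟩ := h
      simpa [oneNeg] using (σ.biadjMatrix_eq_neg_one_iff a b).2 he
    · rw [(σ.biadjMatrix_isSign a b).resolve_right fun h' => ?_]
      · simp [oneNeg, h]
      · have := huniq _ ((σ.biadjMatrix_eq_neg_one_iff a b).1 h')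
        simp at this
        exact h this
  · rintro ⟨i, j, h⟩
    refine ⟨⟨_, inl_inr_mem_edgeSet i j⟩, ?_, fun e he => ?_⟩
    · refine (σ.biadjMatrix_eq_neg_one_iff i j).1 ?_
      simp [h, oneNeg]
    · obtain ⟨a, b, rfl⟩ := exists_eq_inl_inr e
      have := (σ.biadjMatrix_eq_neg_one_iff a b).2 he
      rw [h] at this
      by_cases hab : a = i ∧ b = j
      · obtain ⟨rfl, rfl⟩ := hab
        rfl
      · norm_num [oneNeg, hab] at this

theorem exists_hasOneNegativeEdge (i : α) (j : β) :
    ∃ σ : Signing (completeBipartiteGraph α β), σ.HasOneNegativeEdge := by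
  classical
  refine ⟨fun e => if e = ⟨_, inl_inr_mem_edgeSet i j⟩ then -1 else 1,
    ⟨_, inl_inr_mem_edgeSet i j⟩, by simp, fun e he => ?_⟩
  by_contra h
  simp only [if_neg h] at he
  exact absurd he (by decide)

open Classical in
theorem biadjMatrix_switch (σ : Signing (completeBipartiteGraph α β)) (Z : Set (α ⊕ β))
    (a : α) (b : β) :
    (σ.switch Z).biadjMatrix a b =
      (if Sum.inl a ∈ Z then -1 else 1) * (if Sum.inr b ∈ Z then -1 else 1) *
        σ.biadjMatrix a b := by
  rw [biadjMatrix_apply, biadjMatrix_apply, switch]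
  have h : (∃ u ∈ Z, ∃ v ∉ Z, (s(Sum.inl a, Sum.inr b) : Sym2 (α ⊕ β)) = s(u, v)) ↔
      ((Sum.inl a ∈ Z ∧ Sum.inr b ∉ Z) ∨ (Sum.inr b ∈ Z ∧ Sum.inl a ∉ Z)) := by
    constructor
    · rintro ⟨u, hu, v, hv, huv⟩
      rcases Sym2.eq_iff.1 huv with ⟨rfl, rfl⟩ | ⟨rfl, rfl⟩
      · exact Or.inl ⟨hu, hv⟩
      · exact Or.inr ⟨hu, hv⟩
    · rintro (⟨h1, h2⟩ | ⟨h1, h2⟩)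
      · exact ⟨_, h1, _, h2, rfl⟩
      · exact ⟨_, h1, _, h2, Sym2.eq_swap⟩
  simp only [h]
  by_cases h1 : Sum.inl a ∈ Z <;> by_cases h2 : Sum.inr b ∈ Z <;> simp [h1, h2]

/-- `Sum.elim d e` is a potential: the sign of a walk telescopes to the product of its values at the
two ends, which is `1` on a closed walk. -/
theorem isBalanced_of_biadjMatrix_eq (σ : Signing (completeBipartiteGraph α β))
    {d : α → ℝ} {e : β → ℝ} (hd : ∀ a, d a = 1 ∨ d a = -1) (he : ∀ b, e b = 1 ∨ e b = -1)
    (h : ∀ a b, σ.biadjMatrix a b = d a * e b) : σ.IsBalanced := by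
  have hsq : ∀ v, Sum.elim d e v * Sum.elim d e v = 1 := by
    rintro (a | b)
    · rcases hd a with h | h <;> simp [h]
    · rcases he b with h | h <;> simp [h]
  have hval : ∀ u v, (completeBipartiteGraph α β).Adj u v →
      (σ.val s(u, v) : ℝ) = Sum.elim d e u * Sum.elim d e v := by
    rintro (a | b) (a' | b') huv
    · simp [completeBipartiteGraph] at huv
    · exact h a b'
    · rw [Sym2.eq_swap, mul_comm]
      exact h a' b
    · simp [completeBipartiteGraph] at huv
  have hwalk : ∀ {u v} (w : (completeBipartiteGraph α β).Walk u v),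
      (σ.walkSign w : ℝ) = Sum.elim d e u * Sum.elim d e v := by
    intro u v w
    induction w with
    | nil => simp [walkSign, hsq]
    | @cons u v w huv p ih =>
      have : σ.walkSign (SimpleGraph.Walk.cons huv p) = σ.val s(u, v) * σ.walkSign p := by
        simp [walkSign]
      rw [this, Int.cast_mul, hval u v huv, ih]
      linear_combination (Sum.elim d e u * Sum.elim d e w) * hsq v
  intro v c _
  have := hwalk c
  rw [hsq] at this
  exact_mod_cast this

theorem biadjMatrix_isUnbalancedSign {σ : Signing (completeBipartiteGraph α β)}
    (h : ¬ σ.IsBalanced) : σ.biadjMatrix.IsUnbalancedSign := by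
  refine ⟨σ.biadjMatrix_isSign, fun d e hd he => ?_⟩
  by_contra! hne
  refine h (σ.isBalanced_of_biadjMatrix_eq hd he fun a b => ?_)
  have := hne a b
  rcases hd a with h | h <;> rcases he b with h' | h' <;>
    rcases σ.biadjMatrix_isSign a b with h'' | h'' <;> simp [h, h', h''] at this ⊢

theorem not_isBalanced_of_hasOneNegativeEdge [Nontrivial α] [Nontrivial β]
    {σ : Signing (completeBipartiteGraph α β)} (h : σ.HasOneNegativeEdge) : ¬ σ.IsBalanced := by
  classical
  obtain ⟨i, j, hij⟩ := σ.hasOneNegativeEdge_iff.1 h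
  obtain ⟨i', hi⟩ := exists_ne i
  obtain ⟨j', hj⟩ := exists_ne j
  have adj : ∀ (a : α) (b : β), (completeBipartiteGraph α β).Adj (Sum.inl a) (Sum.inr b) :=
    fun a b => by simp [completeBipartiteGraph]
  intro hbal
  -- A 4-cycle through the negative edge; its other three edges are positive.
  have hc := hbal (Sum.inl i) (.cons (adj i j) (.cons (adj i' j).symm (.cons (adj i' j')
    (.cons (adj i j').symm .nil)))) (by
      rw [SimpleGraph.Walk.cons_isCycle_iff]
      simp [hi, hi.symm, hj.symm])
  have hval : ∀ a b, (σ.val s(Sum.inl a, Sum.inr b) : ℝ) = oneNeg i j a b := fun a b => by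
    rw [← hij]; rfl
  have hc' : (σ.walkSign (.cons (adj i j) (.cons (adj i' j).symm (.cons (adj i' j')
    (.cons (adj i j').symm .nil)))) : ℝ) = 1 := by exact_mod_cast hc
  simp only [walkSign, SimpleGraph.Walk.edges_cons, SimpleGraph.Walk.edges_nil, List.map_cons,
    List.map_nil, List.prod_cons, List.prod_nil, Int.cast_mul, Int.cast_one] at hc'
  rw [Sym2.eq_swap (a := Sum.inr j), Sym2.eq_swap (a := Sum.inr j')] at hc'
  simp only [hval] at hc'
  norm_num [oneNeg, hi, hj] at hc'

/-! ### Termwise comparison of Estrada indices -/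

variable [Fintype α] [Fintype β] [DecidableEq α] [DecidableEq β]

theorem hasSum_estradaIndex (σ : Signing (completeBipartiteGraph α β)) :
    HasSum (fun k : ℕ => (σ.adjMatrix ^ k).trace / k.factorial) σ.estradaIndex :=
  σ.adjMatrix_isHermitian.hasSum_trace_pow_div_factorial

theorem trace_adjMatrix_pow_le {σ τ : Signing (completeBipartiteGraph α β)}
    (h : ∀ k : ℕ, ((σ.biadjMatrix * σ.biadjMatrixᵀ) ^ (k + 1)).trace ≤
      ((τ.biadjMatrix * τ.biadjMatrixᵀ) ^ (k + 1)).trace) (k : ℕ) :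
    (σ.adjMatrix ^ k).trace / k.factorial ≤ (τ.adjMatrix ^ k).trace / k.factorial := by
  rw [adjMatrix_eq_fromBlocks, adjMatrix_eq_fromBlocks]
  refine div_le_div_of_nonneg_right ?_ (by positivity)
  rcases Nat.even_or_odd' k with ⟨l, rfl | rfl⟩
  · rcases l with _ | l
    · simp
    · rw [trace_fromBlocks_zero_pow_even, trace_fromBlocks_zero_pow_even]
      linarith [h l]
  · rw [trace_fromBlocks_zero_pow_odd, trace_fromBlocks_zero_pow_odd]

theorem estradaIndex_le {σ τ : Signing (completeBipartiteGraph α β)}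
    (h : ∀ k : ℕ, ((σ.biadjMatrix * σ.biadjMatrixᵀ) ^ (k + 1)).trace ≤
      ((τ.biadjMatrix * τ.biadjMatrixᵀ) ^ (k + 1)).trace) : σ.estradaIndex ≤ τ.estradaIndex :=
  hasSum_le (trace_adjMatrix_pow_le h) σ.hasSum_estradaIndex τ.hasSum_estradaIndex

theorem trace_sq_eq_of_estradaIndex_eq {σ τ : Signing (completeBipartiteGraph α β)}
    (h : ∀ k : ℕ, ((σ.biadjMatrix * σ.biadjMatrixᵀ) ^ (k + 1)).trace ≤
      ((τ.biadjMatrix * τ.biadjMatrixᵀ) ^ (k + 1)).trace)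
    (heq : σ.estradaIndex = τ.estradaIndex) :
    ((σ.biadjMatrix * σ.biadjMatrixᵀ) ^ 2).trace =
      ((τ.biadjMatrix * τ.biadjMatrixᵀ) ^ 2).trace := by
  by_contra hne
  -- The index `4` is where `tr ((B * Bᵀ) ^ 2)` enters the series.
  refine (hasSum_lt (i := 4) (trace_adjMatrix_pow_le h) ?_ σ.hasSum_estradaIndex
    τ.hasSum_estradaIndex).ne heq
  rw [adjMatrix_eq_fromBlocks, adjMatrix_eq_fromBlocks]
  refine div_lt_div_of_pos_right ?_ (by positivity)
  have h4 := trace_fromBlocks_zero_pow_even σ.biadjMatrix 1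
  have h4' := trace_fromBlocks_zero_pow_even τ.biadjMatrix 1
  norm_num at h4 h4'
  rw [h4, h4']
  linarith [lt_of_le_of_ne (h 1) hne]

end CompleteBipartite

end Signing

/-! ### The main theorem -/

theorem mainTheorem3 (m n : ℕ) (hm : 2 ≤ m) (hn : 2 ≤ n) :
    (∃ σs : Signing (completeBipartiteGraph (Fin m) (Fin n)), σs.HasOneNegativeEdge) ∧
    ∀ σs : Signing (completeBipartiteGraph (Fin m) (Fin n)), σs.HasOneNegativeEdge →
      ¬ σs.IsBalanced ∧
      ∀ σ : Signing (completeBipartiteGraph (Fin m) (Fin n)), ¬ σ.IsBalanced →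
        σ.estradaIndex ≤ σs.estradaIndex ∧
        (σ.estradaIndex = σs.estradaIndex ↔
          ∃ τ : Signing (completeBipartiteGraph (Fin m) (Fin n)),
            τ.HasOneNegativeEdge ∧ σ.SwitchingEquivalent τ) := by
  have : Nontrivial (Fin m) := Fin.nontrivial_iff_two_le.2 hm
  have : Nontrivial (Fin n) := Fin.nontrivial_iff_two_le.2 hn
  refine ⟨Signing.exists_hasOneNegativeEdge ⟨0, by omega⟩ ⟨0, by omega⟩, fun σs hs =>
    ⟨Signing.not_isBalanced_of_hasOneNegativeEdge hs, fun σ hσ => ?_⟩⟩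
  obtain ⟨i, j, hij⟩ := σs.hasOneNegativeEdge_iff.1 hs
  have key := (Signing.biadjMatrix_isUnbalancedSign hσ).trace_pow_le i j
  rw [← hij] at key
  refine ⟨Signing.estradaIndex_le key.1, fun heq => ?_, ?_⟩
  · obtain ⟨d, e, i', j', hd, he, hde⟩ :=
      key.2 (Signing.trace_sq_eq_of_estradaIndex_eq key.1 heq)
    -- Switching at the vertices of sign `-1` multiplies the block entries by `d a * e b`.
    set Z : Set (Fin m ⊕ Fin n) := {v | Sum.elim d e v = -1} with hZ
    refine ⟨σ.switch Z, (Signing.hasOneNegativeEdge_iff _).2 ⟨i', j', ?_⟩, Z, rfl⟩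
    ext a b
    rw [Signing.biadjMatrix_switch, ← hde]
    rcases hd a with h | h <;> rcases he b with h' | h' <;> norm_num [hZ, h, h']
  · rintro ⟨τ, hτ, Z, rfl⟩
    obtain ⟨i', j', hτ⟩ := (Signing.hasOneNegativeEdge_iff _).1 hτ
    have htr : ∀ k : ℕ, ((σ.biadjMatrix * σ.biadjMatrix.transpose) ^ (k + 1)).trace =
        ((σs.biadjMatrix * σs.biadjMatrix.transpose) ^ (k + 1)).trace := by
      intro k
      rw [hij, Matrix.trace_oneNeg_pow i i' j j', ← hτ]
      classical
      refine (Matrix.trace_sign_mul_transpose_pow _ _ _ _ (fun a => ?_) (fun b => ?_)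
        (σ.biadjMatrix_switch Z) _).symm <;> split_ifs <;> norm_num
    exact le_antisymm (Signing.estradaIndex_le fun k => (htr k).le)
      (Signing.estradaIndex_le fun k => (htr k).ge)
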